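/- Let $R$ be a principal ideal domain that is not a field, $\sigma$ an automorphism of $R$ and $0\neq a\in R$. Let $A=R(\sigma,a)$ be the generalized Weyl algebra generated by $R$, $x$, $y$ subject to $x\sigma(r)=rx$, $yr=\sigma(r)y$ $(r\in R)$, $xy=a$, $yx=\sigma(a)$. For a divisor $p$ of $a$ put $q=q_p=\sigma(a/p)$ and let $V_p$ be the $A$-module with underlying abelian group $R$ and action $r'\cdot r=r'r$, $x\cdot r=\sigma^{-1}(r)p$, $y\cdot r=\sigma(r)q$. An $A$-module $M$ is a *weight module* if $M=\bigoplus_{\mathfrak m\in\mathrm{Max}(R)}M_{\mathfrak m}$, where $M_{\mathfrak m}=\{v\in M\mid \mathfrak m v=0\}$; its *support* is $\{\mathfrak m\mid M_{\mathfrak m}\ne 0\}$. For a divisor $p$ of $a$, an element $\hat p$ is obtained as follows. As long as there are an irreducible $q_0\mid q_p$ and $n\ge 0$ with $p_0:=\sigma^n(q_0)\mid p$, choose such a pair for which there are no $0\le i\le j\le n$ with $j-i<n$, $\sigma^i(q_0)\mid q_p$ and $\sigma^j(q_0)\mid p$, and replace $p$ by $\sigma^{-1}(q_0)\,p/p_0$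 (again a divisor of $a$). When no such $q_0$ and $n$ exist, stop; the final element is $\hat p$. **Theorem.** Suppose that for every irreducible $z\in R$ the orbit $\{[\sigma^k(z)]\mid k\in\mathbb Z\}$ of its class modulo associates is infinite. Then: (a) For every divisor $p$ of $a$, the module $V_p$ has finite length, its socle $\mathrm{soc}(V_p)$ is simple and is not a weight module, the above procedure can be carried out to a final element $\hat p$, and $\mathrm{soc}(V_p)\simeq V_{\hat p}$ for every final element $\hat p$ so obtained. All composition factors of $V_p$ except for $\mathrm{soc}(V_p)$ are simple weight modules with finite support: for every composition series $0=M_0\subsetneq M_1\subsetneq\cdots\subsetneq M_\ell=V_p$ one has $M_1=\mathrm{soc}(V_p)$, and $M_{i+1}/M_i$ is a simple weight module with finite support for all $1\le i<\ell$. (b) Every simple weight $A$-module with finite support is isomorphic to a composition factor of $V_p$ for some divisor $p$ of $a$. -/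

import Mathlib

universe u v

/-- Free generators for the generalized Weyl algebra: the elements of `R` and the letters
`x`, `y`. -/
inductive GWAGen (R : Type u) : Type u
  | base (r : R) : GWAGen R
  | x : GWAGen R
  | y : GWAGen R

/-- The defining relations of `R(σ, a)`: the first three say that `R` maps to the algebra by a
unital ring homomorphism, the others are `x σ(r) = r x`, `y r = σ(r) y`, `x y = a` and
`y x = σ(a)`. -/
inductive GWARel {R : Type u} [CommRing R] (σ : RingAut R) (a : R) :
    FreeAlgebra ℤ (GWAGen R) → FreeAlgebra ℤ (GWAGen R) → Prop
  | base_one : GWARel σ a (FreeAlgebra.ι ℤ (.base 1)) 1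
  | base_add (r s : R) : GWARel σ a (FreeAlgebra.ι ℤ (.base (r + s)))
      (FreeAlgebra.ι ℤ (.base r) + FreeAlgebra.ι ℤ (.base s))
  | base_mul (r s : R) : GWARel σ a (FreeAlgebra.ι ℤ (.base (r * s)))
      (FreeAlgebra.ι ℤ (.base r) * FreeAlgebra.ι ℤ (.base s))
  | x_comm (r : R) : GWARel σ a (FreeAlgebra.ι ℤ .x * FreeAlgebra.ι ℤ (.base (σ r)))
      (FreeAlgebra.ι ℤ (.base r) * FreeAlgebra.ι ℤ .x)
  | y_comm (r : R) : GWARel σ a (FreeAlgebra.ι ℤ .y * FreeAlgebra.ι ℤ (.base r))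
      (FreeAlgebra.ι ℤ (.base (σ r)) * FreeAlgebra.ι ℤ .y)
  | x_mul_y : GWARel σ a (FreeAlgebra.ι ℤ .x * FreeAlgebra.ι ℤ .y) (FreeAlgebra.ι ℤ (.base a))
  | y_mul_x : GWARel σ a (FreeAlgebra.ι ℤ .y * FreeAlgebra.ι ℤ .x)
      (FreeAlgebra.ι ℤ (.base (σ a)))

/-- The generalized Weyl algebra `R(σ, a)`, given by its presentation. -/
def GWA {R : Type u} [CommRing R] (σ : RingAut R) (a : R) : Type u :=
  RingQuot (GWARel σ a)

namespace GWA

variable {R : Type u} [CommRing R] (σ : RingAut R) (a : R)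

noncomputable instance : Ring (GWA σ a) :=
  inferInstanceAs (Ring (RingQuot (GWARel σ a)))

/-- The class of a word in the generators. -/
noncomputable def proj : FreeAlgebra ℤ (GWAGen R) →+* GWA σ a :=
  RingQuot.mkRingHom (GWARel σ a)

/-- The canonical homomorphism `R → R(σ, a)`. -/
noncomputable def ofBase : R →+* GWA σ a :=
  RingHom.mk'
    { toFun := fun r => proj σ a (FreeAlgebra.ι ℤ (.base r))
      map_one' := (RingQuot.mkRingHom_rel GWARel.base_one).trans (map_one (proj σ a))
      map_mul' := fun r s =>
        (RingQuot.mkRingHom_rel (GWARel.base_mul r s)).trans (map_mul (proj σ a) _ _) }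
    (fun r s => (RingQuot.mkRingHom_rel (GWARel.base_add r s)).trans (map_add (proj σ a) _ _))

/-- The generator `x` of `R(σ, a)`. -/
noncomputable def x : GWA σ a := proj σ a (FreeAlgebra.ι ℤ .x)

/-- The generator `y` of `R(σ, a)`. -/
noncomputable def y : GWA σ a := proj σ a (FreeAlgebra.ι ℤ .y)

/-- Values on generators of a ring homomorphism out of `R(σ, a)`. -/
def genMap {B : Type v} [Ring B] (f : R →+* B) (X Y : B) : GWAGen R → B
  | .base r => f r
  | .x => X
  | .y => Y

/-- The universal property of the presentation. -/
noncomputable def lift {B : Type v} [Ring B] (f : R →+* B) (X Y : B)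
    (hx : ∀ r, X * f (σ r) = f r * X) (hy : ∀ r, Y * f r = f (σ r) * Y)
    (hxy : X * Y = f a) (hyx : Y * X = f (σ a)) : GWA σ a →+* B :=
  RingQuot.lift ⟨(FreeAlgebra.lift ℤ (genMap f X Y)).toRingHom, by
    intro p q h
    cases h with
    | base_one => simp [genMap]
    | base_add r s => simp [genMap]
    | base_mul r s => simp [genMap]
    | x_comm r => simpa [genMap] using hx r
    | y_comm r => simpa [genMap] using hy r
    | x_mul_y => simpa [genMap] using hxy
    | y_mul_x => simpa [genMap] using hyx⟩

section liftLemmas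

variable {σ a} {B : Type v} [Ring B] (f : R →+* B) (X Y : B)
    (hx : ∀ r, X * f (σ r) = f r * X) (hy : ∀ r, Y * f r = f (σ r) * Y)
    (hxy : X * Y = f a) (hyx : Y * X = f (σ a))

theorem lift_ofBase (r : R) : lift σ a f X Y hx hy hxy hyx (ofBase σ a r) = f r := by
  unfold lift
  refine (RingQuot.lift_mkRingHom_apply _ _ _).trans ?_
  simp [genMap]

theorem lift_x : lift σ a f X Y hx hy hxy hyx (x σ a) = X := by
  unfold lift
  refine (RingQuot.lift_mkRingHom_apply _ _ _).trans ?_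
  simp [genMap]

theorem lift_y : lift σ a f X Y hx hy hxy hyx (y σ a) = Y := by
  unfold lift
  refine (RingQuot.lift_mkRingHom_apply _ _ _).trans ?_
  simp [genMap]

end liftLemmas

end GWA

/-- The element `q = σ(a / p)` attached to a divisor `p` of `a`. (If `a ≠ 0` in a domain, the
cofactor of `p` is unique.) -/
noncomputable def qOf {R : Type u} [CommRing R] (σ : RingAut R) {a p : R} (h : p ∣ a) : R :=
  σ (Classical.choose h)

theorem mul_symm_qOf {R : Type u} [CommRing R] (σ : RingAut R) {a p : R} (h : p ∣ a) :
    p * σ.symm (qOf σ h) = a := by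
  rw [qOf, RingEquiv.symm_apply_apply]
  exact (Classical.choose_spec h).symm

/-- The underlying abelian group `R` of the module `V_p`, for a divisor `p` of `a`. -/
def Vp {R : Type u} [CommRing R] (_σ : RingAut R) {a p : R} (_h : p ∣ a) : Type u := R

namespace Vp

variable {R : Type u} [CommRing R] (σ : RingAut R) {a p : R} (h : p ∣ a)

instance : AddCommGroup (Vp σ h) := inferInstanceAs (AddCommGroup R)

/-- The identity map `R → V_p`. -/
def mk : R ≃+ Vp σ h := AddEquiv.refl R

/-- The action of `R(σ, a)` on `V_p`: `r' · r = r' r`, `x · r = σ⁻¹(r) p`, `y · r = σ(r) q`. -/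
noncomputable def action : GWA σ a →+* AddMonoid.End R :=
  GWA.lift σ a (Module.toAddMonoidEnd R R)
    ((AddMonoidHom.mulRight p).comp (σ.symm : R ≃+* R).toAddEquiv.toAddMonoidHom)
    ((AddMonoidHom.mulRight (qOf σ h)).comp σ.toAddEquiv.toAddMonoidHom)
    (by
      intro r
      ext s
      change σ.symm (σ r * s) * p = r * (σ.symm s * p)
      rw [map_mul, RingEquiv.symm_apply_apply, mul_assoc])
    (by
      intro r
      ext s
      change σ (r * s) * qOf σ h = σ r * (σ s * qOf σ h)
      rw [map_mul, mul_assoc])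
    (by
      ext s
      change σ.symm (σ s * qOf σ h) * p = a * s
      rw [map_mul, RingEquiv.symm_apply_apply]
      linear_combination s * mul_symm_qOf σ h)
    (by
      ext s
      change σ (σ.symm s * p) * qOf σ h = σ a * s
      have := congrArg σ (mul_symm_qOf σ h)
      rw [map_mul, RingEquiv.apply_symm_apply] at this
      rw [map_mul, RingEquiv.apply_symm_apply]
      linear_combination s * this)

noncomputable instance : Module (GWA σ a) (Vp σ h) :=
  Module.compHom R (action σ h)

theorem ofBase_smul (r s : R) : GWA.ofBase σ a r • mk σ h s = mk σ h (r * s) :=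
  congrArg (fun φ : AddMonoid.End R => φ s) (GWA.lift_ofBase _ _ _ _ _ _ _ r)

theorem x_smul (s : R) : GWA.x σ a • mk σ h s = mk σ h (σ.symm s * p) :=
  congrArg (fun φ : AddMonoid.End R => φ s) (GWA.lift_x _ _ _ _ _ _ _)

theorem y_smul (s : R) : GWA.y σ a • mk σ h s = mk σ h (σ s * qOf σ h) :=
  congrArg (fun φ : AddMonoid.End R => φ s) (GWA.lift_y _ _ _ _ _ _ _)

end Vp

/-- The orbit `{[σᵏ(r)] : k ∈ ℤ}` of the class of `r` modulo associates. -/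
def assocOrbit {R : Type u} [CommRing R] (σ : RingAut R) (r : R) : Set (Associates R) :=
  Set.range fun k : ℤ => Associates.mk ((σ ^ k) r)

/-- All orbits of `⟨σ⟩` in the set of irreducibles modulo associates are infinite. -/
def InfiniteIrrOrbits {R : Type u} [CommRing R] (σ : RingAut R) : Prop :=
  ∀ z : R, Irreducible z → (assocOrbit σ z).Infinite

section Weight

variable {R : Type u} [CommRing R] (σ : RingAut R) (a : R)
  (M : Type v) [AddCommGroup M] [Module (GWA σ a) M]

/-- The weight space `M_𝔪 = {v ∈ M : 𝔪 v = 0}`. -/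
noncomputable def weightSpace (m : MaximalSpectrum R) : AddSubgroup M where
  carrier := {w | ∀ r ∈ m.asIdeal, GWA.ofBase σ a r • w = 0}
  zero_mem' := fun r _ => smul_zero _
  add_mem' := fun {w w'} hw hw' r hr => by rw [smul_add, hw r hr, hw' r hr, add_zero]
  neg_mem' := fun {w} hw r hr => by rw [smul_neg, hw r hr, neg_zero]

open Classical in
/-- `M` is a weight module: it is the direct sum of its weight spaces. -/
def IsWeightModule : Prop :=
  DirectSum.IsInternal (weightSpace σ a M)

/-- The support of `M`. -/
def weightSupport : Set (MaximalSpectrum R) :=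
  {m | weightSpace σ a M m ≠ ⊥}

end Weight

section Modules

variable (A : Type u) [Ring A] (M : Type v) [AddCommGroup M] [Module A M]

/-- The socle: the sum of all simple submodules. -/
def socle : Submodule A M :=
  sSup {N : Submodule A M | IsSimpleModule A N}

variable {A M}

/-- The `i`-th factor `M_{i+1} / M_i` of a composition series `M_0 < M_1 < ⋯ < M_ℓ`. -/
abbrev CompFactor (s : CompositionSeries (Submodule A M)) (i : Fin s.length) : Type v :=
  (s i.succ : Submodule A M) ⧸ (s i.castSucc : Submodule A M).submoduleOf (s i.succ)

end Modules

section Socle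

variable {R : Type u} [CommRing R] (σ : RingAut R) {a : R}

/-- `Ω_p = ∅`: there are no irreducibles `z ∣ q` and `w ∣ p`, up to associates, with
`w = σⁿ(z)` for some `n ≥ 0`. -/
def OmegaEmpty (p : {p : R // p ∣ a}) : Prop :=
  ∀ z : R, Irreducible z → z ∣ qOf σ p.2 → ∀ n : ℕ, ¬ (σ ^ n) z ∣ p.1

/-- One step `p ↦ p' = σ⁻¹(q₀) p / p₀` of the algorithm that leads from `p` to `p̂`: here
`q₀ ∣ q` and `p₀ = σⁿ(q₀) ∣ p` are irreducible with `n ≥ 0`, and there is no strictly shorter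
pair `(σⁱ(q₀), σʲ(q₀))` with the same property inside the chain `q₀, σ(q₀), …, σⁿ(q₀)`. -/
def SocleStep (p p' : {p : R // p ∣ a}) : Prop :=
  ∃ (q₀ : R) (n : ℕ), Irreducible q₀ ∧ q₀ ∣ qOf σ p.2 ∧ (σ ^ n) q₀ ∣ p.1 ∧
    (∀ i j : ℕ, i ≤ j → j ≤ n → j - i < n →
      ¬ ((σ ^ i) q₀ ∣ qOf σ p.2 ∧ (σ ^ j) q₀ ∣ p.1)) ∧
    p'.1 * (σ ^ n) q₀ = σ.symm q₀ * p.1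

/-- `p'` is a final outcome `p̂` of the algorithm started at `p`. -/
def IsHat (p p' : {p : R // p ∣ a}) : Prop :=
  Relation.ReflTransGen (SocleStep σ) p p' ∧ OmegaEmpty σ p'

end Socle

/-! Submodules of `V_p` are the ideals `(d)` of `R` with `d ∣ σ⁻¹(d) p` and `d ∣ σ(d) q`. Iterating,
`d` divides `σ⁻ⁿ(d) ∏_{i<n} σ⁻ⁱ(p)` and `σⁿ(d) ∏_{i<n} σⁱ(q)`. Infinite orbits make `σ^{±n}(d)`
coprime to `d ≠ 0` for large `n`, so `d` divides both products. If `σⁿ(q)` is coprime to `p` for all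
`n ≥ N`, only the first `N` factors of the `p`-product survive (`dvd_prod_of_isCoprime`). All
nonzero `d` thus divide one nonzero element, and `V_p` has finitely many submodules. If no
irreducible of `q` moves forward to one of `p`, then `N = 0` works and `V_p` is simple.

Nonzero ideals of a domain meet, so the socle is the unique simple submodule. Each step of the
algorithm embeds `V_{p'}` properly into `V_p`. Hence the algorithm can be run to an end, and the
simple module `V_p̂` lands on the socle. The socle is `R`-torsion-free, so it has no weight vectors.
Every higher composition factor is killed by some nonzero element of `R`, which for a simple module
forces weight vectors and finite support.

For (b), a simple weight module with finite support has a nonzero weight vector `w`, of weight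
`(z)`, with `y w = 0`. Suitable multiples of the `xⁱ w` add up to a vector `u` with `x u = z u` and
`y u = q_z u` (`exists_vector`). So `1 ↦ u` maps `V_z` onto the module. -/

namespace GWA

/-! ### Divisibility and coprimality along the orbits of σ -/

section Arithmetic

variable {R : Type u} [CommRing R] (σ : RingAut R)

theorem zpow_apply_zpow_apply (j k : ℤ) (r : R) : (σ ^ j) ((σ ^ k) r) = (σ ^ (j + k)) r := by
  rw [zpow_add, RingAut.mul_apply]

theorem apply_zpow_apply (k : ℤ) (r : R) : σ ((σ ^ k) r) = (σ ^ (1 + k)) r := by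
  rw [zpow_one_add, RingAut.mul_apply]

theorem irreducible_zpow {z : R} (hz : Irreducible z) (k : ℤ) : Irreducible ((σ ^ k) z) :=
  (MulEquiv.irreducible_iff (σ ^ k : RingAut R)).2 hz

/-- A coincidence of two classes makes the orbit map periodic, hence its range finite. -/
theorem mk_zpow_injective {z : R} (hz : (assocOrbit σ z).Infinite) :
    Function.Injective fun k : ℤ => Associates.mk ((σ ^ k) z) := by
  have key : ∀ j T : ℤ, 0 < T →
      Associates.mk ((σ ^ j) z) ≠ Associates.mk ((σ ^ (j + T)) z) := by
    intro j T hT hjT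
    have hper : Function.Periodic (fun k : ℤ => Associates.mk ((σ ^ k) z)) T := by
      intro k
      have h := (Associates.mk_eq_mk_iff_associated.1 hjT).map (σ ^ (k - j) : RingAut R)
      rw [zpow_apply_zpow_apply, zpow_apply_zpow_apply] at h
      refine (Associates.mk_eq_mk_iff_associated.2 ?_)
      convert h.symm using 3 <;> ring
    refine hz (((Set.finite_Ico 0 T).image fun k : ℤ => Associates.mk ((σ ^ k) z)).subset ?_)
    rintro _ ⟨k, rfl⟩
    obtain ⟨i, hi, h⟩ := hper.exists_mem_Ico₀ hT k
    exact ⟨i, hi, h.symm⟩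
  intro j k hjk
  rcases lt_trichotomy j k with h | h | h
  · exact absurd (by simpa using hjk) (key j (k - j) (by omega))
  · exact h
  · exact absurd (by simpa using hjk.symm) (key k (j - k) (by omega))

theorem dvd_pow_mul_prod {d p : R} (h : d ∣ σ d * p) (n : ℕ) :
    d ∣ (σ ^ n) d * ∏ i ∈ Finset.range n, (σ ^ i) p := by
  induction n with
  | zero => simp
  | succ n ih =>
    have h1 := map_dvd (σ ^ n : RingAut R) h
    rw [map_mul, ← RingAut.mul_apply, ← pow_succ] at h1
    refine ih.trans ((mul_dvd_mul_right h1 _).trans (dvd_of_eq ?_))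
    rw [Finset.prod_range_succ]
    ring

variable [IsDomain R] [IsPrincipalIdealRing R]

/-- Peeling off irreducible factors on both sides leaves two irreducibles. There, failure of
coprimality means being associated, which an infinite orbit allows for at most one `k`. -/
theorem finite_not_isCoprime (hσ : InfiniteIrrOrbits σ) {b c : R} (hb : b ≠ 0) (hc : c ≠ 0) :
    {k : ℤ | ¬ IsCoprime ((σ ^ k) b) c}.Finite := by
  induction b using WfDvdMonoid.induction_on_irreducible with
  | zero => exact absurd rfl hb
  | unit u hu =>
    convert Set.finite_empty
    ext k
    simpa using (isCoprime_one_left.of_isCoprime_of_dvd_left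
      (hu.map (σ ^ k : RingAut R)).dvd : IsCoprime _ c)
  | mul b z hb' hz ih =>
    refine (Set.Finite.union (s := {k : ℤ | ¬ IsCoprime ((σ ^ k) z) c}) ?_ (ih hb')).subset ?_
    · clear ih hb
      induction c using WfDvdMonoid.induction_on_irreducible with
      | zero => exact absurd rfl hc
      | unit u hu =>
        convert Set.finite_empty
        ext k
        simpa using
          (isCoprime_one_right.of_isCoprime_of_dvd_right hu.dvd : IsCoprime ((σ ^ k) z) _)
      | mul c w hc' hw ih =>
        refine (Set.Finite.union (s := {k : ℤ | ¬ IsCoprime ((σ ^ k) z) w}) ?_ (ih hc')).subset ?_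
        · refine Set.Subsingleton.finite fun j hj k hk => mk_zpow_injective σ (hσ z hz) ?_
          have key : ∀ i : ℤ, ¬ IsCoprime ((σ ^ i) z) w → Associated ((σ ^ i) z) w := by
            intro i hi
            have hd : ((σ ^ i) z) ∣ w := by
              by_contra h
              exact hi (((irreducible_zpow σ hz i).coprime_iff_not_dvd).2 h)
            exact (irreducible_zpow σ hz i).associated_of_dvd hw hd
          exact Associates.mk_eq_mk_iff_associated.2 ((key j hj).trans (key k hk).symm)
        · intro k hk
          by_contra h
          simp only [Set.mem_union, Set.mem_ofPred_eq, not_or, not_not] at h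
          exact hk (h.1.mul_right h.2)
    · intro k hk
      by_contra h
      simp only [Set.mem_union, Set.mem_ofPred_eq, not_or, not_not] at h
      refine hk ?_
      rw [map_mul]
      exact h.1.mul_left h.2

theorem exists_forall_isCoprime (hσ : InfiniteIrrOrbits σ) {b c : R} (hb : b ≠ 0) (hc : c ≠ 0) :
    ∃ N : ℕ, ∀ k : ℤ, (N : ℤ) ≤ |k| → IsCoprime ((σ ^ k) b) c := by
  obtain ⟨N, hN⟩ := ((finite_not_isCoprime σ hσ hb hc).image fun k => k.natAbs).bddAbove
  refine ⟨N + 1, fun k hk => ?_⟩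
  by_contra h
  have : k.natAbs ≤ N := hN ⟨k, h, rfl⟩
  rw [Int.abs_eq_natAbs] at hk
  omega

/-- A common multiple, depending only on `p` and `N`, of all `d` as in the hypotheses. -/
theorem dvd_prod_of_isCoprime (hσ : InfiniteIrrOrbits σ) {p q d : R} {N : ℕ} (hd : d ≠ 0)
    (hN : ∀ n : ℕ, N ≤ n → IsCoprime ((σ ^ n) q) p)
    (hp : d ∣ σ.symm d * p) (hq : d ∣ σ d * q) :
    d ∣ ∏ i ∈ Finset.range N, (σ⁻¹ ^ i) p := by
  obtain ⟨n₀, hn₀⟩ := exists_forall_isCoprime σ hσ hd hd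
  have hpos : IsCoprime ((σ ^ (n₀ + N)) d) d := by
    have := hn₀ (n₀ + N : ℕ) (by rw [abs_of_nonneg] <;> omega)
    rwa [zpow_natCast] at this
  have hneg : IsCoprime ((σ⁻¹ ^ (n₀ + N)) d) d := by
    have := hn₀ (-(n₀ + N : ℕ)) (by rw [abs_neg, abs_of_nonneg] <;> omega)
    rwa [zpow_neg, zpow_natCast, ← inv_pow] at this
  have hP : d ∣ ∏ i ∈ Finset.range (n₀ + N), (σ⁻¹ ^ i) p :=
    hneg.symm.dvd_of_dvd_mul_left (dvd_pow_mul_prod σ⁻¹ hp _)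
  have hQ : d ∣ ∏ i ∈ Finset.range (n₀ + N), (σ ^ i) q :=
    hpos.symm.dvd_of_dvd_mul_left (dvd_pow_mul_prod σ hq _)
  -- The factors `σ⁻ⁱ(p)` with `i ≥ N` are coprime to every `σʲ(q)`, hence to `d`, which divides the
  -- product of the latter; they can be cancelled.
  rw [add_comm n₀, Finset.prod_range_add] at hP
  refine IsCoprime.dvd_of_dvd_mul_right ?_ hP
  refine IsCoprime.of_isCoprime_of_dvd_left ?_ hQ
  refine IsCoprime.prod_left fun j _ => IsCoprime.prod_right fun i _ => ?_
  have := (hN (N + i + j) (by omega)).map (σ⁻¹ ^ (N + i) : RingAut R).toRingHom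
  simp only [RingEquiv.toRingHom_eq_coe, RingEquiv.coe_toRingHom] at this
  rwa [← RingAut.mul_apply, inv_pow, pow_add σ (N + i), inv_mul_cancel_left, ← inv_pow] at this

theorem exists_forall_dvd (hσ : InfiniteIrrOrbits σ) {p q : R} (hp0 : p ≠ 0) (hq0 : q ≠ 0) :
    ∃ D : R, D ≠ 0 ∧ ∀ d : R, d ≠ 0 → d ∣ σ.symm d * p → d ∣ σ d * q → d ∣ D := by
  obtain ⟨N, hN⟩ := exists_forall_isCoprime σ hσ hq0 hp0
  refine ⟨∏ i ∈ Finset.range N, (σ⁻¹ ^ i) p, ?_, fun d hd h1 h2 =>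
    dvd_prod_of_isCoprime σ hσ hd (fun n hn => ?_) h1 h2⟩
  · exact Finset.prod_ne_zero_iff.2 fun i _ =>
      (map_ne_zero_iff _ (σ⁻¹ ^ i : RingAut R).injective).2 hp0
  · have := hN n (by rw [abs_of_nonneg] <;> omega)
    rwa [zpow_natCast] at this

/-- Here the bound `N = 0` is admissible, and `d` divides an empty product. -/
theorem isUnit_of_omegaEmpty (hσ : InfiniteIrrOrbits σ) {a : R} {p : {p : R // p ∣ a}}
    (hp0 : p.1 ≠ 0) (hΩ : OmegaEmpty σ p) {d : R} (hd : d ≠ 0)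
    (h1 : d ∣ σ.symm d * p.1) (h2 : d ∣ σ d * qOf σ p.2) : IsUnit d := by
  refine isUnit_of_dvd_one ?_
  have := dvd_prod_of_isCoprime σ hσ (N := 0) hd (fun n _ => ?_) h1 h2
  · simpa using this
  · refine isCoprime_of_irreducible_dvd (fun h => hp0 h.2) fun z hz hzq hzp => ?_
    refine hΩ ((σ⁻¹ ^ n) z) ((MulEquiv.irreducible_iff (σ⁻¹ ^ n : RingAut R)).2 hz) ?_ n ?_
    · have := map_dvd (σ⁻¹ ^ n : RingAut R) hzq
      rwa [← RingAut.mul_apply, inv_pow, inv_mul_cancel, ← inv_pow] at this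
    · rwa [← RingAut.mul_apply, inv_pow, mul_inv_cancel]

end Arithmetic

/-! ### Working with the generators of the algebra -/

section Presentation

variable {R : Type u} [CommRing R] {σ : RingAut R} {a : R}

theorem induction {C : GWA σ a → Prop} (base : ∀ r, C (ofBase σ a r)) (hx : C (x σ a))
    (hy : C (y σ a)) (add : ∀ b c, C b → C c → C (b + c)) (mul : ∀ b c, C b → C c → C (b * c))
    (b : GWA σ a) : C b := by
  obtain ⟨w, rfl⟩ : ∃ w, proj σ a w = b := RingQuot.mkRingHom_surjective _ b
  induction w using FreeAlgebra.induction with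
  | grade0 n =>
    have h : proj σ a (algebraMap ℤ _ n) = ofBase σ a (n : R) := by simp
    rw [h]
    exact base _
  | grade1 g =>
    cases g with
    | base r => exact base r
    | x => exact hx
    | y => exact hy
  | mul b c hb hc => rw [map_mul]; exact mul _ _ hb hc
  | add b c hb hc => rw [map_add]; exact add _ _ hb hc

theorem x_mul_ofBase (r : R) : x σ a * ofBase σ a (σ r) = ofBase σ a r * x σ a :=
  (map_mul (proj σ a) _ _).symm.trans
    ((RingQuot.mkRingHom_rel (GWARel.x_comm (σ := σ) (a := a) r)).trans (map_mul (proj σ a) _ _))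

theorem x_mul_ofBase' (r : R) : x σ a * ofBase σ a r = ofBase σ a (σ.symm r) * x σ a := by
  rw [← x_mul_ofBase, RingEquiv.apply_symm_apply]

theorem y_mul_ofBase (r : R) : y σ a * ofBase σ a r = ofBase σ a (σ r) * y σ a :=
  (map_mul (proj σ a) _ _).symm.trans
    ((RingQuot.mkRingHom_rel (GWARel.y_comm (σ := σ) (a := a) r)).trans (map_mul (proj σ a) _ _))

theorem x_mul_y : x σ a * y σ a = ofBase σ a a :=
  (map_mul (proj σ a) _ _).symm.trans
    (RingQuot.mkRingHom_rel (GWARel.x_mul_y (σ := σ) (a := a)))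

theorem y_mul_x : y σ a * x σ a = ofBase σ a (σ a) :=
  (map_mul (proj σ a) _ _).symm.trans
    (RingQuot.mkRingHom_rel (GWARel.y_mul_x (σ := σ) (a := a)))

variable {M : Type v} [AddCommGroup M] [Module (GWA σ a) M]
  {M' : Type*} [AddCommGroup M'] [Module (GWA σ a) M']

/-- An additive subgroup stable under the generators is a submodule. -/
def submoduleOfStable (N : AddSubgroup M) (base : ∀ r, ∀ v ∈ N, ofBase σ a r • v ∈ N)
    (hx : ∀ v ∈ N, x σ a • v ∈ N) (hy : ∀ v ∈ N, y σ a • v ∈ N) : Submodule (GWA σ a) M where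
  carrier := N
  zero_mem' := N.zero_mem
  add_mem' := N.add_mem
  smul_mem' b := by
    induction b using GWA.induction with
    | base r => exact fun {v} => base r v
    | hx => exact fun {v} => hx v
    | hy => exact fun {v} => hy v
    | add b c hb hc => intro v hv; rw [add_smul]; exact N.add_mem (hb hv) (hc hv)
    | mul b c hb hc => intro v hv; rw [mul_smul]; exact hb (hc hv)

/-- An additive map that commutes with the generators is linear. -/
def linearMapOfCommutes (f : M →+ M') (base : ∀ r v, f (ofBase σ a r • v) = ofBase σ a r • f v)
    (hx : ∀ v, f (x σ a • v) = x σ a • f v) (hy : ∀ v, f (y σ a • v) = y σ a • f v) :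
    M →ₗ[GWA σ a] M' where
  toFun := f
  map_add' := map_add f
  map_smul' b := by
    induction b using GWA.induction with
    | base r => exact base r
    | hx => exact hx
    | hy => exact hy
    | add b c hb hc => 
      intro v
      simp only [add_smul, map_add, hb, hc, RingHom.id_apply]
    | mul b c hb hc => 
      intro v
      simp only [mul_smul, hb, hc, RingHom.id_apply]

end Presentation

end GWA

/-! ### Homomorphisms out of `V_p` -/

namespace Vp

variable {R : Type u} [CommRing R] {σ : RingAut R} {a p : R} {h : p ∣ a}
  {M : Type v} [AddCommGroup M] [Module (GWA σ a) M]

theorem exists_eq_mk (w : Vp σ h) : ∃ r, w = mk σ h r := ⟨w, rfl⟩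

theorem mk_eq_zero {r : R} : mk σ h r = 0 ↔ r = 0 := Iff.rfl

/-- The universal property of `V_p`. -/
noncomputable def homOfVector (w : M) (hx : GWA.x σ a • w = GWA.ofBase σ a p • w)
    (hy : GWA.y σ a • w = GWA.ofBase σ a (qOf σ h) • w) : Vp σ h →ₗ[GWA σ a] M :=
  GWA.linearMapOfCommutes
    { toFun := fun r => GWA.ofBase σ a ((mk σ h).symm r) • w
      map_zero' := by simp
      map_add' := fun r s => by simp [add_smul] }
    (by
      intro r w'
      obtain ⟨s, hs⟩ := exists_eq_mk w'
      rw [hs]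
      simp [ofBase_smul, mul_smul])
    (by
      intro w'
      obtain ⟨s, hs⟩ := exists_eq_mk w'
      rw [hs]
      simp only [x_smul, AddMonoidHom.coe_mk, ZeroHom.coe_mk, AddEquiv.symm_apply_apply]
      rw [map_mul, mul_smul, ← hx, ← mul_smul, ← mul_smul, GWA.x_mul_ofBase'])
    (by
      intro w'
      obtain ⟨s, hs⟩ := exists_eq_mk w'
      rw [hs]
      simp only [y_smul, AddMonoidHom.coe_mk, ZeroHom.coe_mk, AddEquiv.symm_apply_apply]
      rw [map_mul, mul_smul, ← hy, ← mul_smul, ← mul_smul, GWA.y_mul_ofBase])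

theorem homOfVector_mk (w : M) (hx : GWA.x σ a • w = GWA.ofBase σ a p • w)
    (hy : GWA.y σ a • w = GWA.ofBase σ a (qOf σ h) • w) (r : R) :
    homOfVector w hx hy (mk σ h r) = GWA.ofBase σ a r • w := rfl

end Vp

/-! ### Submodules of `V_p` as ideals, finite length and socle -/

namespace Vp

variable {R : Type u} [CommRing R] {σ : RingAut R} {a p : R} {h : p ∣ a}

theorem mul_qOf (h : p ∣ a) : σ p * qOf σ h = σ a := by
  have := congrArg σ (mul_symm_qOf σ h)
  rwa [map_mul, RingEquiv.apply_symm_apply] at this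

theorem qOf_ne_zero (ha : a ≠ 0) (h : p ∣ a) : qOf σ h ≠ 0 := by
  intro hq
  have := mul_symm_qOf σ h
  rw [hq, map_zero, mul_zero] at this
  exact ha this.symm

/-- The ideal of `R` underlying a submodule of `V_p`. -/
def toIdeal (N : Submodule (GWA σ a) (Vp σ h)) : Ideal R where
  carrier := {r | mk σ h r ∈ N}
  zero_mem' := N.zero_mem
  add_mem' := fun hr hs => N.add_mem hr hs
  smul_mem' := fun r s hs => by
    change mk σ h (r * s) ∈ N
    rw [← ofBase_smul]
    exact N.smul_mem _ hs

theorem mem_toIdeal {N : Submodule (GWA σ a) (Vp σ h)} {r : R} :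
    r ∈ toIdeal N ↔ mk σ h r ∈ N := Iff.rfl

theorem toIdeal_injective :
    Function.Injective (toIdeal : Submodule (GWA σ a) (Vp σ h) → Ideal R) := by
  intro N N' hN
  ext w
  exact (SetLike.ext_iff.1 hN) ((mk σ h).symm w)

/-- The two divisibilities express stability of `(d)` under `x` and `y`. -/
theorem exists_generator [IsPrincipalIdealRing R] (N : Submodule (GWA σ a) (Vp σ h)) :
    ∃ d : R, toIdeal N = Ideal.span {d} ∧ d ∣ σ.symm d * p ∧ d ∣ σ d * qOf σ h := by
  obtain ⟨d, hd⟩ := (IsPrincipalIdealRing.principal (toIdeal N)).principal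
  change toIdeal N = Ideal.span {d} at hd
  have hdN : mk σ h d ∈ N := mem_toIdeal.1 (hd ▸ Ideal.mem_span_singleton_self d)
  refine ⟨d, hd, ?_, ?_⟩
  · rw [← Ideal.mem_span_singleton, ← hd, mem_toIdeal, ← x_smul]
    exact N.smul_mem _ hdN
  · rw [← Ideal.mem_span_singleton, ← hd, mem_toIdeal, ← y_smul]
    exact N.smul_mem _ hdN

theorem toIdeal_eq_bot_iff {N : Submodule (GWA σ a) (Vp σ h)} : toIdeal N = ⊥ ↔ N = ⊥ := by
  have : toIdeal (⊥ : Submodule (GWA σ a) (Vp σ h)) = ⊥ := by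
    ext r
    rfl
  rw [← this, toIdeal_injective.eq_iff]

instance [Nontrivial R] : Nontrivial (Vp σ h) := inferInstanceAs (Nontrivial R)

theorem exists_socleStep {p : {p : R // p ∣ a}} (hp : ¬ OmegaEmpty σ p) :
    ∃ p', SocleStep σ p p' := by
  classical
  have hex : ∃ n : ℕ, ∃ z : R, Irreducible z ∧ z ∣ qOf σ p.2 ∧ (σ ^ n) z ∣ p.1 := by
    by_contra hcon
    exact hp fun z hz hzq n hn => hcon ⟨n, z, hz, hzq, hn⟩
  -- The exponent is minimal among all admissible pairs, so no shorter pair can occur inside the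
  -- chain of `z`.
  obtain ⟨z, hz, hzq, hzp⟩ := Nat.find_spec hex
  obtain ⟨p₁, hp₁⟩ := hzp
  obtain ⟨q₁, hq₁⟩ := hzq
  have ha' := mul_symm_qOf σ p.2
  rw [hq₁, map_mul] at ha'
  refine ⟨⟨σ.symm z * p₁, ⟨(σ ^ Nat.find hex) z * σ.symm q₁, ?_⟩⟩, z, Nat.find hex, hz,
    ⟨q₁, hq₁⟩, ⟨p₁, hp₁⟩, ?_, ?_⟩
  · linear_combination -ha' + σ.symm z * σ.symm q₁ * hp₁
  · intro i j hij _ hlt hdvd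
    refine Nat.find_min hex hlt ⟨(σ ^ i) z,
      (MulEquiv.irreducible_iff (σ ^ i : RingAut R)).2 hz, hdvd.1, ?_⟩
    rw [← RingAut.mul_apply, ← pow_add, Nat.sub_add_cancel hij]
    exact hdvd.2
  · change σ.symm z * p₁ * _ = _
    linear_combination -σ.symm z * hp₁

section Domain

variable [IsDomain R]

/-- The product of nonzero elements of the two ideals lies in both. -/
theorem inf_ne_bot {N N' : Submodule (GWA σ a) (Vp σ h)} (hN : N ≠ ⊥) (hN' : N' ≠ ⊥) :
    N ⊓ N' ≠ ⊥ := by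
  obtain ⟨w, hw, hw0⟩ := Submodule.exists_mem_ne_zero_of_ne_bot hN
  obtain ⟨w', hw', hw0'⟩ := Submodule.exists_mem_ne_zero_of_ne_bot hN'
  obtain ⟨r, hr⟩ := exists_eq_mk w
  obtain ⟨s, hs⟩ := exists_eq_mk w'
  rw [hr, ← mem_toIdeal] at hw
  rw [hs, ← mem_toIdeal] at hw'
  rw [hr, Ne, mk_eq_zero] at hw0
  rw [hs, Ne, mk_eq_zero] at hw0'
  refine Submodule.ne_bot_iff _ |>.2 ⟨mk σ h (r * s), ⟨?_, ?_⟩, fun h0 =>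
    mul_ne_zero hw0 hw0' (mk_eq_zero.1 h0)⟩
  · exact (toIdeal N).mul_mem_right _ hw
  · exact (toIdeal N').mul_mem_left _ hw'

theorem socle_eq_of_isSimpleModule (N : Submodule (GWA σ a) (Vp σ h))
    (hN : IsSimpleModule (GWA σ a) N) : socle (GWA σ a) (Vp σ h) = N := by
  refine le_antisymm (sSup_le fun N' hN' => ?_) (le_sSup hN)
  have h1 := isSimpleModule_iff_isAtom.1 hN
  have h2 := isSimpleModule_iff_isAtom.1 hN'
  exact inf_eq_left.1 ((h2.le_iff.1 inf_le_left).resolve_left (inf_ne_bot h2.1 h1.1))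

/-- If `p' d = σ⁻¹(d) p`, then multiplication by `d` embeds `V_{p'}` into `V_p`. -/
theorem exists_injective_of_mul_eq (ha : a ≠ 0) {p' d : R} (h' : p' ∣ a) (hd : d ≠ 0)
    (hpd : p' * d = σ.symm d * p) :
    ∃ f : Vp σ h' →ₗ[GWA σ a] Vp σ h, Function.Injective f ∧ ∀ r, f (mk σ h' r) = mk σ h (r * d) := by
  have hp0 : σ p' ≠ 0 := (map_ne_zero_iff _ σ.injective).2 (ne_zero_of_dvd_ne_zero ha h')
  have hq : qOf σ h' * d = σ d * qOf σ h := by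
    have h1 := congrArg σ hpd
    rw [map_mul, map_mul, RingEquiv.apply_symm_apply] at h1
    refine mul_left_cancel₀ hp0 ?_
    linear_combination d * mul_qOf (σ := σ) h' - d * mul_qOf (σ := σ) h - qOf σ h * h1
  refine ⟨homOfVector (mk σ h d) ?_ ?_, ?_, fun r => ?_⟩
  · rw [x_smul, ofBase_smul, hpd]
  · rw [y_smul, ofBase_smul, hq]
  · rw [injective_iff_map_eq_zero]
    intro w hw
    obtain ⟨r, hr⟩ := exists_eq_mk w
    rw [hr, homOfVector_mk, ofBase_smul, mk_eq_zero] at hw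
    rw [hr, mk_eq_zero]
    exact (mul_eq_zero.1 hw).resolve_right hd
  · rw [homOfVector_mk, ofBase_smul]

/-- The embedding is multiplication by `d = q₀ σ(q₀) ⋯ σⁿ(q₀)`: telescoping gives `σ⁻¹(d) σⁿ(q₀) =
σ⁻¹(q₀) d`, whence `p' d = σ⁻¹(d) p`. It is not onto because `q₀` divides `d`. -/
theorem exists_injective_of_socleStep (ha : a ≠ 0) {p p' : {p : R // p ∣ a}}
    (hstep : SocleStep σ p p') :
    ∃ f : Vp σ p'.2 →ₗ[GWA σ a] Vp σ p.2, Function.Injective f ∧ ¬ Function.Surjective f := by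
  obtain ⟨q₀, n, hq₀, -, -, -, hp'⟩ := hstep
  have hdvd : q₀ ∣ ∏ i ∈ Finset.range (n + 1), (σ ^ i) q₀ := by
    simpa using Finset.dvd_prod_of_mem (fun i => (σ ^ i) q₀) (a := 0)
      (s := Finset.range (n + 1)) (by simp)
  have hne : ∀ i, (σ ^ i) q₀ ≠ 0 := fun i =>
    (map_ne_zero_iff _ (σ ^ i : RingAut R).injective).2 hq₀.ne_zero
  have hd : ∏ i ∈ Finset.range (n + 1), (σ ^ i) q₀ ≠ 0 := Finset.prod_ne_zero_iff.2 fun i _ => hne i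
  have htel : σ.symm (∏ i ∈ Finset.range (n + 1), (σ ^ i) q₀) * (σ ^ n) q₀ =
      σ.symm q₀ * ∏ i ∈ Finset.range (n + 1), (σ ^ i) q₀ := by
    rw [map_prod, Finset.prod_range_succ', Finset.prod_range_succ (fun i => (σ ^ i) q₀)]
    have : ∀ i, σ.symm ((σ ^ (i + 1)) q₀) = (σ ^ i) q₀ := fun i => by
      rw [pow_succ', RingAut.mul_apply, RingEquiv.symm_apply_apply]
    simp only [this, pow_zero, RingAut.one_apply]
    ring
  obtain ⟨f, hf, hfr⟩ := exists_injective_of_mul_eq (σ := σ) (h := p.2) (p' := p'.1) ha p'.2 hd (by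
    refine mul_right_cancel₀ (hne n) ?_
    linear_combination (∏ i ∈ Finset.range (n + 1), (σ ^ i) q₀) * hp' - p.1 * htel)
  refine ⟨f, hf, fun hs => ?_⟩
  obtain ⟨w, hw⟩ := hs (mk σ p.2 1)
  obtain ⟨r, hr⟩ := exists_eq_mk w
  rw [hr, hfr] at hw
  have := (mk σ p.2).injective hw
  exact hq₀.not_isUnit (isUnit_of_dvd_one (this ▸ hdvd.mul_left r))

theorem exists_injective_of_reflTransGen (ha : a ≠ 0) {p p' : {p : R // p ∣ a}}
    (hpp : Relation.ReflTransGen (SocleStep σ) p p') :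
    ∃ f : Vp σ p'.2 →ₗ[GWA σ a] Vp σ p.2, Function.Injective f := by
  induction hpp with
  | refl => exact ⟨LinearMap.id, Function.injective_id⟩
  | tail _ hstep ih =>
    obtain ⟨f, hf⟩ := ih
    obtain ⟨g, hg, -⟩ := exists_injective_of_socleStep ha hstep
    exact ⟨f.comp g, hf.comp hg⟩

variable [IsPrincipalIdealRing R]

theorem finite_setOf_dvd_span {D : R} (hD0 : D ≠ 0) :
    {I : Ideal R | I ∣ Ideal.span {D}}.Finite := by
  have := UniqueFactorizationMonoid.fintypeSubtypeDvd (Ideal.span {D})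
    (mt Ideal.span_singleton_eq_bot.1 hD0)
  exact Set.finite_coe_iff.1 (Finite.of_injective
    (fun I => (⟨I.1, I.2⟩ : {I : Ideal R // I ∣ Ideal.span {D}}))
    fun I J hIJ => Subtype.ext (congrArg Subtype.val hIJ :))

theorem finite_submodule (hσ : InfiniteIrrOrbits σ) (ha : a ≠ 0) :
    Finite (Submodule (GWA σ a) (Vp σ h)) := by
  obtain ⟨D, hD0, hD⟩ :=
    GWA.exists_forall_dvd σ hσ (ne_zero_of_dvd_ne_zero ha h) (qOf_ne_zero (σ := σ) ha h)
  have hfin := finite_setOf_dvd_span hD0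
  refine Set.finite_univ_iff.1 (Set.Finite.subset ((hfin.insert ⊥).preimage
    (toIdeal_injective (σ := σ) (h := h)).injOn) fun N _ => ?_)
  obtain ⟨d, hd, h1, h2⟩ := exists_generator N
  rcases eq_or_ne d 0 with rfl | hd0
  · left
    rw [hd]; simp
  · right
    rw [hd]
    exact Ideal.dvd_iff_le.2 (Ideal.span_singleton_le_span_singleton.2 (hD d hd0 h1 h2))

theorem isFiniteLength (hσ : InfiniteIrrOrbits σ) (ha : a ≠ 0) :
    IsFiniteLength (GWA σ a) (Vp σ h) := by
  have := finite_submodule (h := h) hσ ha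
  exact isFiniteLength_iff_isNoetherian_isArtinian.2
    ⟨isNoetherian_iff'.2 inferInstance, inferInstance⟩

theorem isSimpleModule_socle (hσ : InfiniteIrrOrbits σ) (ha : a ≠ 0) :
    IsSimpleModule (GWA σ a) (socle (GWA σ a) (Vp σ h)) := by
  have := finite_submodule (h := h) hσ ha
  obtain ⟨N, hN, -⟩ := (eq_bot_or_exists_atom_le (⊤ : Submodule (GWA σ a) (Vp σ h))).resolve_left
    top_ne_bot
  have hN' := isSimpleModule_iff_isAtom.2 hN
  rwa [socle_eq_of_isSimpleModule N hN']

theorem isSimpleModule_of_omegaEmpty (hσ : InfiniteIrrOrbits σ) (ha : a ≠ 0)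
    {p : {p : R // p ∣ a}} (hp : OmegaEmpty σ p) : IsSimpleModule (GWA σ a) (Vp σ p.2) := by
  refine (isSimpleModule_iff _ _).2 ?_
  refine @IsSimpleOrder.mk _ _ _ inferInstance fun N => ?_
  obtain ⟨d, hd, h1, h2⟩ := exists_generator N
  rcases eq_or_ne d 0 with rfl | hd0
  · left
    rw [← toIdeal_eq_bot_iff, hd]
    simp
  · right
    have := GWA.isUnit_of_omegaEmpty σ hσ (ne_zero_of_dvd_ne_zero ha p.2) hp hd0 h1 h2
    refine toIdeal_injective (hd.trans ?_)
    rw [Ideal.span_singleton_eq_top.2 this]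
    rfl

theorem exists_isHat (hσ : InfiniteIrrOrbits σ) (ha : a ≠ 0) (p : {p : R // p ∣ a}) :
    ∃ p', IsHat σ p p' := by
  have := finite_submodule (h := p.2) hσ ha
  -- Termination: the image inside the fixed module `V_p` shrinks strictly at each step, so
  -- induction runs on that image.
  suffices H : ∀ (N : Submodule (GWA σ a) (Vp σ p.2)) (p' : {p : R // p ∣ a})
      (f : Vp σ p'.2 →ₗ[GWA σ a] Vp σ p.2), Function.Injective f → LinearMap.range f = N →
      ∃ p'', IsHat σ p' p'' from H ⊤ p LinearMap.id Function.injective_id LinearMap.range_id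
  intro N
  induction N using WellFoundedLT.induction with
  | ind N ih =>
    intro p' f hf hN
    by_cases hΩ : OmegaEmpty σ p'
    · exact ⟨p', .refl, hΩ⟩
    · obtain ⟨p₁, hstep⟩ := exists_socleStep hΩ
      obtain ⟨g, hg, hgs⟩ := exists_injective_of_socleStep ha hstep
      obtain ⟨p₂, h₂, h₃⟩ := ih (LinearMap.range (f.comp g)) (by
        rw [← hN]
        refine lt_of_le_of_ne (LinearMap.range_comp_le_range g f) fun heq => hgs fun w => ?_
        have hw : f w ∈ LinearMap.range (f.comp g) := heq ▸ LinearMap.mem_range_self f w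
        obtain ⟨w', hw'⟩ := hw
        exact ⟨w', hf hw'⟩) p₁ (f.comp g) (hf.comp hg) rfl
      exact ⟨p₂, .head hstep h₂, h₃⟩

theorem socle_equiv_of_isHat (hσ : InfiniteIrrOrbits σ) (ha : a ≠ 0) {p p' : {p : R // p ∣ a}}
    (hp : IsHat σ p p') : Nonempty (socle (GWA σ a) (Vp σ p.2) ≃ₗ[GWA σ a] Vp σ p'.2) := by
  obtain ⟨f, hf⟩ := exists_injective_of_reflTransGen ha hp.1
  have hs := isSimpleModule_of_omegaEmpty hσ ha hp.2
  let e := LinearEquiv.ofInjective f hf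
  have hr : IsSimpleModule (GWA σ a) (LinearMap.range f) := IsSimpleModule.congr e.symm
  rw [socle_eq_of_isSimpleModule _ hr]
  exact ⟨e.symm⟩

end Domain

end Vp

/-! ### Weight spaces and weight modules -/

section Weight

variable {R : Type u} [CommRing R] {σ : RingAut R} {a : R}
  {M : Type v} [AddCommGroup M] [Module (GWA σ a) M]

theorem mem_weightSpace {m : MaximalSpectrum R} {w : M} :
    w ∈ weightSpace σ a M m ↔ ∀ r ∈ m.asIdeal, GWA.ofBase σ a r • w = 0 := Iff.rfl

theorem ofBase_smul_comm (r s : R) (w : M) :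
    GWA.ofBase σ a r • GWA.ofBase σ a s • w = GWA.ofBase σ a s • GWA.ofBase σ a r • w := by
  rw [← mul_smul, ← mul_smul, ← map_mul, ← map_mul, mul_comm]

theorem eq_zero_of_isCoprime {b c : R} (h : IsCoprime b c) {w : M}
    (hb : GWA.ofBase σ a b • w = 0) (hc : GWA.ofBase σ a c • w = 0) : w = 0 := by
  obtain ⟨s, t, hst⟩ := h
  have := congrArg (fun r => GWA.ofBase σ a r • w) hst
  simpa [add_smul, mul_smul, hb, hc] using this.symm

theorem mem_weightSpace_span {z : R} {m : MaximalSpectrum R} (hm : m.asIdeal = Ideal.span {z})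
    {w : M} : w ∈ weightSpace σ a M m ↔ GWA.ofBase σ a z • w = 0 := by
  rw [mem_weightSpace, hm]
  refine ⟨fun h => h z (Ideal.mem_span_singleton_self z), fun h r hr => ?_⟩
  obtain ⟨s, rfl⟩ := Ideal.mem_span_singleton'.1 hr
  rw [map_mul, mul_smul, h, smul_zero]

theorem smul_x_smul (r : R) (w : M) :
    GWA.ofBase σ a r • GWA.x σ a • w = GWA.x σ a • GWA.ofBase σ a (σ r) • w := by
  rw [← mul_smul, ← mul_smul, GWA.x_mul_ofBase]

theorem smul_y_smul (r : R) (w : M) :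
    GWA.ofBase σ a (σ r) • GWA.y σ a • w = GWA.y σ a • GWA.ofBase σ a r • w := by
  rw [← mul_smul, ← mul_smul, GWA.y_mul_ofBase]

theorem IsWeightModule.exists_weightSpace_ne_bot [Nontrivial M] (h : IsWeightModule σ a M) :
    ∃ m, weightSpace σ a M m ≠ ⊥ := by
  classical
  by_contra! hbot
  obtain ⟨w, hw⟩ := exists_ne (0 : M)
  obtain ⟨t, rfl⟩ := h.surjective w
  refine hw ?_
  have : t = 0 := by
    ext m
    exact AddSubgroup.mem_bot.1 ((hbot m).le (t m).2)
  rw [this, map_zero]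

/-- The automorphism `τ` acting on maximal ideals by preimage. -/
def comapMaximal (τ : RingAut R) (m : MaximalSpectrum R) : MaximalSpectrum R :=
  ⟨m.asIdeal.comap τ, haveI := m.isMaximal; Ideal.comap_isMaximal_of_equiv τ⟩

theorem x_smul_mem_weightSpace {m : MaximalSpectrum R} {w : M} (hw : w ∈ weightSpace σ a M m) :
    GWA.x σ a • w ∈ weightSpace σ a M (comapMaximal σ m) := fun r hr => by
  rw [smul_x_smul, hw (σ r) hr, smul_zero]

theorem y_smul_mem_weightSpace {m : MaximalSpectrum R} {w : M} (hw : w ∈ weightSpace σ a M m) :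
    GWA.y σ a • w ∈ weightSpace σ a M (comapMaximal σ.symm m) := fun r hr => by
  have := smul_y_smul (a := a) (σ := σ) (σ.symm r) w
  rw [RingEquiv.apply_symm_apply] at this
  rw [this, hw (σ.symm r) hr, smul_zero]

theorem ofBase_smul_mem_weightSpace {m : MaximalSpectrum R} {w : M} (s : R)
    (hw : w ∈ weightSpace σ a M m) : GWA.ofBase σ a s • w ∈ weightSpace σ a M m := fun r hr => by
  rw [ofBase_smul_comm, hw r hr, smul_zero]

variable (σ a M) in
/-- The sum of the weight spaces, as a submodule. -/
noncomputable def weightSum : Submodule (GWA σ a) M :=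
  GWA.submoduleOfStable (⨆ m, weightSpace σ a M m)
    (fun r w hw => by
      induction hw using AddSubgroup.iSup_induction' with
      | hp m w hw => exact AddSubgroup.mem_iSup_of_mem m (ofBase_smul_mem_weightSpace r hw)
      | h1 => rw [smul_zero]; exact zero_mem _
      | hadd w w' _ _ h h' => rw [smul_add]; exact add_mem h h')
    (fun w hw => by
      induction hw using AddSubgroup.iSup_induction' with
      | hp m w hw => exact AddSubgroup.mem_iSup_of_mem _ (x_smul_mem_weightSpace hw)
      | h1 => rw [smul_zero]; exact zero_mem _
      | hadd w w' _ _ h h' => rw [smul_add]; exact add_mem h h')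
    (fun w hw => by
      induction hw using AddSubgroup.iSup_induction' with
      | hp m w hw => exact AddSubgroup.mem_iSup_of_mem _ (y_smul_mem_weightSpace hw)
      | h1 => rw [smul_zero]; exact zero_mem _
      | hadd w w' _ _ h h' => rw [smul_add]; exact add_mem h h')

theorem mem_weightSum {w : M} : w ∈ weightSum σ a M ↔ w ∈ ⨆ m, weightSpace σ a M m := Iff.rfl

theorem isWeightModule_of_weightSum_eq_top (h : weightSum σ a M = ⊤) : IsWeightModule σ a M := by
  classical
  -- Over `R` the weight spaces are torsion submodules for pairwise comaximal ideals, hence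
  -- independent.
  let _ : Module R M := Module.compHom M (GWA.ofBase σ a)
  let W : MaximalSpectrum R → Submodule R M := fun m =>
    { weightSpace σ a M m with smul_mem' := fun r w hw => ofBase_smul_mem_weightSpace r hw }
  have hW : ∀ m, W m = Submodule.torsionBySet R M m.asIdeal := by
    intro m
    ext w
    rw [Submodule.mem_torsionBySet_iff]
    exact ⟨fun hw r => hw r.1 r.2, fun hw r hr => hw ⟨r, hr⟩⟩
  have key : DirectSum.IsInternal W := by
    rw [DirectSum.isInternal_submodule_iff_iSupIndep_and_iSup_eq_top]
    constructor
    · rw [iSupIndep_iff_supIndep]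
      intro S
      rw [show W = fun m => Submodule.torsionBySet R M m.asIdeal from funext hW]
      refine Submodule.supIndep_torsionBySet_ideal fun m _ m' _ hmm => ?_
      exact m.isMaximal.coprime_of_ne m'.isMaximal fun heq => hmm (MaximalSpectrum.ext heq)
    · rw [eq_top_iff]
      intro w _
      have hw : w ∈ ⨆ m, weightSpace σ a M m := by
        rw [← mem_weightSum, h]
        trivial
      have hle : (⨆ m, weightSpace σ a M m) ≤ (⨆ m, W m).toAddSubgroup :=
        iSup_le fun m w hw => (le_iSup W m) hw
      exact hle hw
  exact key

variable [IsDomain R] [IsPrincipalIdealRing R]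

/-- Stripping irreducible factors from `d` one by one, the last multiple of `w` that is still
nonzero is killed by an irreducible. -/
theorem exists_weightSpace_ne_bot {d : R} (hd : d ≠ 0) {w : M} (hw : w ≠ 0)
    (hdw : GWA.ofBase σ a d • w = 0) : ∃ m, weightSpace σ a M m ≠ ⊥ := by
  induction d using WfDvdMonoid.induction_on_irreducible with
  | zero => exact absurd rfl hd
  | unit u hu => exact absurd (eq_zero_of_isCoprime
      (isCoprime_one_right.of_isCoprime_of_dvd_right hu.dvd) hdw hdw) hw
  | mul b z hb hz ih =>
    by_cases hbw : GWA.ofBase σ a b • w = 0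
    · exact ih hb hbw
    · refine ⟨⟨Ideal.span {z}, PrincipalIdealRing.isMaximal_of_irreducible hz⟩, fun hbot => hbw ?_⟩
      rw [← AddSubgroup.mem_bot, ← hbot, mem_weightSpace_span rfl, ← mul_smul, ← map_mul]
      exact hdw

theorem isWeightModule_of_isSimpleModule [IsSimpleModule (GWA σ a) M] {d : R} (hd : d ≠ 0)
    (hdM : ∀ w : M, GWA.ofBase σ a d • w = 0) : IsWeightModule σ a M := by
  have := IsSimpleModule.nontrivial (GWA σ a) M
  obtain ⟨w, hw⟩ := exists_ne (0 : M)
  obtain ⟨m, hm⟩ := exists_weightSpace_ne_bot hd hw (hdM w)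
  refine isWeightModule_of_weightSum_eq_top ((eq_bot_or_eq_top _).resolve_left fun hbot => hm ?_)
  rw [eq_bot_iff]
  intro w hw
  have : w ∈ weightSum σ a M := AddSubgroup.mem_iSup_of_mem m hw
  rwa [hbot] at this

/-- A maximal ideal in the support must contain `d`, so it divides `(d)`. -/
theorem finite_weightSupport {d : R} (hd : d ≠ 0) (hdM : ∀ w : M, GWA.ofBase σ a d • w = 0) :
    (weightSupport σ a M).Finite := by
  refine ((Vp.finite_setOf_dvd_span hd).preimage
    (f := MaximalSpectrum.asIdeal) fun m _ m' _ h => MaximalSpectrum.ext h).subset fun m hm => ?_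
  refine Ideal.dvd_iff_le.2 ((Ideal.span_singleton_le_iff_mem _).2 ?_)
  by_contra hdm
  refine hm (eq_bot_iff.2 fun w hw => ?_)
  obtain ⟨r, s, hs, hrs⟩ := m.isMaximal.exists_inv hdm
  have := congrArg (fun r => GWA.ofBase σ a r • w) hrs
  simpa [add_smul, mul_smul, hdM, mem_weightSpace.1 hw s hs] using this.symm

end Weight

/-! ### Composition factors of `V_p` -/

namespace Vp

variable {R : Type u} [CommRing R] [IsDomain R] {σ : RingAut R} {a p : R}
  {h : p ∣ a}

theorem not_isWeightModule_submodule (hR : ¬ IsField R) {N : Submodule (GWA σ a) (Vp σ h)}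
    (hN : N ≠ ⊥) : ¬ IsWeightModule σ a N := by
  intro hw
  have : Nontrivial N := Submodule.nontrivial_iff_ne_bot.2 hN
  obtain ⟨m, hm⟩ := hw.exists_weightSpace_ne_bot
  refine hm (eq_bot_iff.2 fun w hw => ?_)
  obtain ⟨r, hr, hr0⟩ := Submodule.exists_mem_ne_zero_of_ne_bot
    (Ring.ne_bot_of_isMaximal_of_not_isField m.isMaximal hR)
  have h1 := congrArg Subtype.val (mem_weightSpace.1 hw r hr)
  obtain ⟨s, hs⟩ := exists_eq_mk w.1
  rw [Submodule.coe_smul, hs, ofBase_smul, Submodule.coe_zero, mk_eq_zero] at h1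
  rw [AddSubgroup.mem_bot]
  exact Subtype.ext (hs.trans (mk_eq_zero.2 ((mul_eq_zero.1 h1).resolve_left hr0)))

theorem compFactor_zero (s : CompositionSeries (Submodule (GWA σ a) (Vp σ h))) (hs : s.head = ⊥)
    (i : Fin s.length) (hi : (i : ℕ) = 0) : s i.succ = socle (GWA σ a) (Vp σ h) := by
  have hcov : s i.castSucc ⋖ s i.succ := s.step i
  have h0 : s i.castSucc = ⊥ := by
    rw [← hs, RelSeries.head]
    congr 1
    exact Fin.ext hi
  rw [h0, bot_covBy_iff] at hcov
  exact (socle_eq_of_isSimpleModule _ (isSimpleModule_iff_isAtom.2 hcov)).symm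

variable [IsPrincipalIdealRing R]

theorem compFactor_pos (s : CompositionSeries (Submodule (GWA σ a) (Vp σ h))) (i : Fin s.length)
    (hi : (i : ℕ) ≠ 0) : IsSimpleModule (GWA σ a) (CompFactor s i) ∧
      IsWeightModule σ a (CompFactor s i) ∧ (weightSupport σ a (CompFactor s i)).Finite := by
  have hcov : s i.castSucc ⋖ s i.succ := s.step i
  have hsimple : IsSimpleModule (GWA σ a) (CompFactor s i) :=
    (covBy_iff_quot_is_simple hcov.le).1 hcov
  have hne : s i.castSucc ≠ ⊥ := by
    have hlt : s 0 < s i.castSucc := s.strictMono (Fin.lt_def.2 (Nat.pos_of_ne_zero hi))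
    exact (bot_le.trans_lt hlt).ne'
  -- Any nonzero `d` in the lower submodule, an ideal of `R`, annihilates the factor.
  obtain ⟨w, hw, hw0⟩ := Submodule.exists_mem_ne_zero_of_ne_bot hne
  obtain ⟨d, hd⟩ := exists_eq_mk w
  rw [hd] at hw
  rw [hd, Ne, mk_eq_zero] at hw0
  have hkill : ∀ w : CompFactor s i, GWA.ofBase σ a d • w = 0 := by
    intro w
    obtain ⟨w, rfl⟩ := Submodule.Quotient.mk_surjective _ w
    rw [← Submodule.Quotient.mk_smul, Submodule.Quotient.mk_eq_zero]
    change ((GWA.ofBase σ a d • w : s i.succ) : Vp σ h) ∈ s i.castSucc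
    obtain ⟨r, hr⟩ := exists_eq_mk w.1
    rw [Submodule.coe_smul, hr, ofBase_smul]
    exact (toIdeal (s i.castSucc)).mul_mem_right r hw
  exact ⟨hsimple, isWeightModule_of_isSimpleModule hw0 hkill, finite_weightSupport hw0 hkill⟩

end Vp

/-! ### Simple weight modules with finite support -/

section FiniteSupport

variable {R : Type u} [CommRing R] [IsPrincipalIdealRing R] {σ : RingAut R} {a : R}
  {M : Type v} [AddCommGroup M] [Module (GWA σ a) M]

theorem GWA.isCoprime_zpow (hσ : InfiniteIrrOrbits σ) {z : R} (hz : Irreducible z) {j k : ℤ}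
    (hjk : j ≠ k) : IsCoprime ((σ ^ j) z) ((σ ^ k) z) := by
  refine (irreducible_zpow σ hz j).coprime_iff_not_dvd.2 fun hdvd => hjk ?_
  exact mk_zpow_injective σ (hσ z hz) (Associates.mk_eq_mk_iff_associated.2
    ((irreducible_zpow σ hz j).associated_of_dvd (irreducible_zpow σ hz k) hdvd))

variable [IsDomain R]

/-- Vectors of pairwise different weights in the orbit of `z` cannot all be nonzero. -/
theorem exists_eq_zero_of_finite_weightSupport (hσ : InfiniteIrrOrbits σ)
    (hfin : (weightSupport σ a M).Finite) {z : R} (hz : Irreducible z) {f : ℕ → ℤ}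
    (hf : Function.Injective f) (w : ℕ → M)
    (hw : ∀ k, GWA.ofBase σ a ((σ ^ f k) z) • w k = 0) : ∃ k, w k = 0 := by
  by_contra! hne
  let m : ℕ → MaximalSpectrum R := fun k => ⟨Ideal.span {(σ ^ f k) z},
    PrincipalIdealRing.isMaximal_of_irreducible (GWA.irreducible_zpow σ hz (f k))⟩
  have hm : Function.Injective m := fun j k hjk => by
    have h1 := congrArg MaximalSpectrum.asIdeal hjk
    refine hf (GWA.mk_zpow_injective σ (hσ z hz) (Associates.mk_eq_mk_iff_associated.2 ?_))
    exact Ideal.span_singleton_eq_span_singleton.1 h1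
  refine Set.infinite_range_of_injective hm (hfin.subset ?_)
  rintro _ ⟨k, rfl⟩ hbot
  refine hne k (AddSubgroup.mem_bot.1 (hbot ▸ ?_))
  exact (mem_weightSpace_span rfl).2 (hw k)

/-- The vectors `yᵏ w` have pairwise different weights `(σᵏ(z))`, so one vanishes; the last one
before the first zero is taken. -/
theorem exists_y_smul_eq_zero (hR : ¬ IsField R) (hσ : InfiniteIrrOrbits σ)
    (hfin : (weightSupport σ a M).Finite) {m : MaximalSpectrum R} (hm : weightSpace σ a M m ≠ ⊥) :
    ∃ (z : R) (w : M), Irreducible z ∧ w ≠ 0 ∧ GWA.ofBase σ a z • w = 0 ∧ GWA.y σ a • w = 0 := by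
  classical
  obtain ⟨z, hz⟩ := (IsPrincipalIdealRing.principal m.asIdeal).principal
  change m.asIdeal = Ideal.span {z} at hz
  have hz0 : z ≠ 0 := by
    rintro rfl
    exact Ring.ne_bot_of_isMaximal_of_not_isField m.isMaximal hR (hz.trans (by simp))
  have hirr : Irreducible z :=
    ((Ideal.span_singleton_prime hz0).1 (hz ▸ m.isMaximal.isPrime)).irreducible
  obtain ⟨w, hw, hw0⟩ := (AddSubgroup.bot_or_exists_ne_zero _).resolve_left hm
  rw [mem_weightSpace_span hz] at hw
  have hwt : ∀ k : ℕ, GWA.ofBase σ a ((σ ^ (k : ℤ)) z) • GWA.y σ a ^ k • w = 0 := by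
    intro k
    induction k with
    | zero => simpa using hw
    | succ k ih =>
      rw [show ((k + 1 : ℕ) : ℤ) = 1 + k by push_cast; ring, ← GWA.apply_zpow_apply, pow_succ',
        mul_smul, smul_y_smul, ih, smul_zero]
  have hex := exists_eq_zero_of_finite_weightSupport hσ hfin hirr
    (f := fun k : ℕ => (k : ℤ)) (fun i j hij => by simpa using hij) _ hwt
  obtain ⟨k, hk⟩ : ∃ k, Nat.find hex = k + 1 := by
    refine Nat.exists_eq_succ_of_ne_zero fun h0 => hw0 ?_
    simpa [h0] using Nat.find_spec hex
  refine ⟨_, _, GWA.irreducible_zpow σ hirr k, Nat.find_min hex (by omega), hwt k, ?_⟩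
  rw [← mul_smul, ← pow_succ', ← hk]
  exact Nat.find_spec hex

/-- The vector is `u = e₀ + ⋯ + e_N` with `e₀ = w` and `e_{N+1} = 0`, where `e_i` has weight
`(σ⁻ⁱ(z))`. The `e_i` are scaled so that `x e_i = z e_{i+1}` and `y e_{i+1} = q e_i`; both sums then
shift by one index, as `z e₀ = 0` and `y e₀ = 0`. -/
theorem exists_vector (hσ : InfiniteIrrOrbits σ) (hfin : (weightSupport σ a M).Finite) {z : R}
    {w : M} (hz : Irreducible z) (hw : w ≠ 0) (hzw : GWA.ofBase σ a z • w = 0)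
    (hyw : GWA.y σ a • w = 0) (hza : z ∣ a) :
    ∃ u : M, u ≠ 0 ∧ GWA.x σ a • u = GWA.ofBase σ a z • u ∧
      GWA.y σ a • u = GWA.ofBase σ a (qOf σ hza) • u := by
  have hcop : ∀ i : ℕ, IsCoprime z ((σ ^ (-(i + 1) : ℤ)) z) := fun i => by
    simpa using GWA.isCoprime_zpow hσ hz (j := 0) (k := -(i + 1)) (by omega)
  -- `α i` inverts `z` modulo `σ^{-(i+1)}(z)`, the weight of `x e_i`.
  choose α β hαβ using hcop
  let e : ℕ → M := fun i => Nat.rec w (fun i v => GWA.ofBase σ a (α i) • GWA.x σ a • v) i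
  have he : ∀ i, e (i + 1) = GWA.ofBase σ a (α i) • GWA.x σ a • e i := fun _ => rfl
  have hwt : ∀ i : ℕ, GWA.ofBase σ a ((σ ^ (-i : ℤ)) z) • e i = 0 := by
    intro i
    induction i with
    | zero => simpa using! hzw
    | succ i ih =>
      rw [he, ofBase_smul_comm, smul_x_smul, GWA.apply_zpow_apply]
      rw [show (1 : ℤ) + -((i + 1 : ℕ) : ℤ) = -i by push_cast; ring, ih, smul_zero, smul_zero]
  have hx : ∀ i, GWA.x σ a • e i = GWA.ofBase σ a z • e (i + 1) := by
    intro i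
    have h1 : GWA.ofBase σ a ((σ ^ (-(i + 1) : ℤ)) z) • GWA.x σ a • e i = 0 := by
      rw [smul_x_smul, GWA.apply_zpow_apply]
      rw [show (1 : ℤ) + (-(i + 1) : ℤ) = -i by ring, hwt, smul_zero]
    have h2 := congrArg (fun r => GWA.ofBase σ a r • GWA.x σ a • e i) (hαβ i)
    simp only [map_add, map_mul, add_smul, mul_smul, h1, smul_zero, add_zero, map_one,
      one_smul] at h2
    rw [he, ofBase_smul_comm, h2]
  -- Applied to `v = y e_{i+1} - q e_i`: its weight is `(σ⁻ⁱ(z))`, and `σ(z)` kills it because `y x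
  -- = σ(a) = σ(z) q`.
  have hcancel : ∀ (i : ℕ) (v : M), GWA.ofBase σ a ((σ ^ (-i : ℤ)) z) • v = 0 →
      GWA.ofBase σ a (σ z) • v = 0 → v = 0 := fun i v h1 h2 => by
    refine eq_zero_of_isCoprime (GWA.isCoprime_zpow hσ hz (j := -i) (k := 1) (by omega)) h1 ?_
    rwa [zpow_one]
  have hy : ∀ i, GWA.y σ a • e (i + 1) = GWA.ofBase σ a (qOf σ hza) • e i := by
    intro i
    rw [← sub_eq_zero]
    refine hcancel i _ ?_ ?_
    · rw [smul_sub, ofBase_smul_comm _ (qOf σ hza), hwt, smul_zero, sub_zero]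
      rw [show (-i : ℤ) = 1 + (-(i + 1 : ℕ) : ℤ) by push_cast; ring, ← GWA.apply_zpow_apply,
        smul_y_smul, hwt, smul_zero]
    · rw [smul_sub, smul_y_smul, ← hx, ← mul_smul, ← mul_smul, GWA.y_mul_x, ← map_mul,
        Vp.mul_qOf, sub_self]
  obtain ⟨N, hN⟩ := exists_eq_zero_of_finite_weightSupport hσ hfin hz
    (f := fun i : ℕ => (-i : ℤ)) (fun i j hij => by simpa using hij) e hwt
  cases N with
  | zero => exact absurd hN hw
  | succ N => ?_
  refine ⟨∑ i ∈ Finset.range (N + 1), e i, fun hu => hw ?_, ?_, ?_⟩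
  -- This product kills every `e_i` with `1 ≤ i ≤ N` but is coprime to `z`, so `u = 0` would force
  -- `w = 0`.
  · have hprod : IsCoprime z (∏ i ∈ Finset.range N, (σ ^ (-(i + 1) : ℤ)) z) :=
      IsCoprime.prod_right fun i _ => ⟨α i, β i, hαβ i⟩
    refine eq_zero_of_isCoprime hprod hzw ?_
    have h1 := congrArg (fun v =>
      GWA.ofBase σ a (∏ i ∈ Finset.range N, (σ ^ (-(i + 1) : ℤ)) z) • v) hu
    simp only [smul_zero, Finset.sum_range_succ', smul_add, Finset.smul_sum] at h1
    rwa [Finset.sum_eq_zero, zero_add] at h1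
    intro i hi
    rw [← Finset.prod_erase_mul _ _ hi, map_mul, mul_smul]
    have := hwt (i + 1)
    push_cast at this
    rw [this, smul_zero]
  · rw [Finset.smul_sum, Finset.smul_sum, Finset.sum_congr rfl fun i _ => hx i,
      Finset.sum_range_succ, hN, smul_zero, add_zero, Finset.sum_range_succ']
    rw [show GWA.ofBase σ a z • e 0 = 0 from hzw, add_zero]
  · rw [Finset.smul_sum, Finset.smul_sum, Finset.sum_range_succ', Finset.sum_congr rfl fun i _ => hy i,
      show GWA.y σ a • e 0 = 0 from hyw, add_zero, Finset.sum_range_succ _ N, ← hy N, hN, smul_zero,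
      add_zero]

theorem exists_surjective_of_finite_weightSupport (hR : ¬ IsField R) (hσ : InfiniteIrrOrbits σ)
    [IsSimpleModule (GWA σ a) M] (hw : IsWeightModule σ a M)
    (hfin : (weightSupport σ a M).Finite) :
    ∃ (p : {p : R // p ∣ a}) (f : Vp σ p.2 →ₗ[GWA σ a] M), Function.Surjective f := by
  have := IsSimpleModule.nontrivial (GWA σ a) M
  obtain ⟨m, hm⟩ := hw.exists_weightSpace_ne_bot
  obtain ⟨z, w, hz, hw, hzw, hyw⟩ := exists_y_smul_eq_zero hR hσ hfin hm
  -- Since `a w = x y w = 0`, coprimality of `z` and `a` would give `w = 0`.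
  have hza : z ∣ a := by
    by_contra hndvd
    refine hw (eq_zero_of_isCoprime (hz.coprime_iff_not_dvd.2 hndvd) hzw ?_)
    rw [← GWA.x_mul_y, mul_smul, hyw, smul_zero]
  obtain ⟨u, hu, hxu, hyu⟩ := exists_vector hσ hfin hz hw hzw hyw hza
  refine ⟨⟨z, hza⟩, Vp.homOfVector u hxu hyu, LinearMap.surjective_of_ne_zero fun h0 => hu ?_⟩
  have := congrArg (fun f : Vp σ hza →ₗ[GWA σ a] M => f (Vp.mk σ hza 1)) h0
  simpa [Vp.homOfVector_mk] using this

end FiniteSupport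

/-- A simple quotient of a module of finite length is a composition factor. -/
theorem exists_compFactor_equiv_of_surjective {A : Type u} [Ring A] {V : Type u} [AddCommGroup V]
    [Module A V] {M : Type v} [AddCommGroup M] [Module A M] (hV : IsFiniteLength A V)
    [IsSimpleModule A M] (f : V →ₗ[A] M) (hf : Function.Surjective f) :
    ∃ s : CompositionSeries (Submodule A V), s.head = ⊥ ∧ s.last = ⊤ ∧
      ∃ i : Fin s.length, Nonempty (M ≃ₗ[A] CompFactor s i) := by
  obtain ⟨_, _⟩ := isFiniteLength_iff_isNoetherian_isArtinian.1 hV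
  have hcoatom : IsCoatom (LinearMap.ker f) := isSimpleModule_iff_isCoatom.1
    (IsSimpleModule.congr (f.quotKerEquivOfSurjective hf))
  obtain ⟨b, hb0, n, hbn, hb⟩ :=
    exists_covBy_seq_of_wellFoundedLT_wellFoundedGT_of_le (bot_le : ⊥ ≤ LinearMap.ker f)
  -- A maximal chain from `⊥` to the kernel of `f`, extended by `⊤`; the quotient in question is the
  -- top factor.
  let s : CompositionSeries (Submodule A V) :=
    { length := n + 1
      toFun := fun i => if (i : ℕ) ≤ n then b i else ⊤
      step := fun i => by
        change (if (i : ℕ) ≤ n then b i else ⊤) ⋖ (if (i : ℕ) + 1 ≤ n then b (i + 1) else ⊤)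
        rw [if_pos (Nat.lt_succ_iff.1 i.2)]
        split_ifs with hi
        · exact hb i hi
        · rw [show (i : ℕ) = n by omega, hbn]
          exact hcoatom.covBy_top }
  have hhead : s.head = ⊥ := by
    change (if (0 : ℕ) ≤ n then b 0 else ⊤) = ⊥
    rw [if_pos (Nat.zero_le n), hb0]
  have hlast : s.last = ⊤ := if_neg (Nat.not_succ_le_self n)
  refine ⟨s, hhead, hlast, Fin.last n, ⟨?_⟩⟩
  have h1 : s (Fin.last n).castSucc = LinearMap.ker f := (if_pos le_rfl).trans hbn
  have h2 : s (Fin.last n).succ = ⊤ := hlast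
  change M ≃ₗ[A] (s (Fin.last n).succ : Submodule A V) ⧸
    (s (Fin.last n).castSucc : Submodule A V).submoduleOf (s (Fin.last n).succ)
  rw [h1, h2]
  exact ((f.comp (⊤ : Submodule A V).subtype).quotKerEquivOfSurjective
    (hf.comp fun w => ⟨⟨w, trivial⟩, rfl⟩)).symm

theorem mainTheorem7 {R : Type u} [CommRing R] [IsDomain R] [IsPrincipalIdealRing R]
    (hR : ¬ IsField R) (σ : RingAut R) (hσ : InfiniteIrrOrbits σ) (a : R) (ha : a ≠ 0) :
    -- part (a)
    (∀ p : {p : R // p ∣ a},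
      IsFiniteLength (GWA σ a) (Vp σ p.2) ∧
      -- the socle is simple, is not a weight module, and is isomorphic to `V_p̂`
      IsSimpleModule (GWA σ a) (socle (GWA σ a) (Vp σ p.2)) ∧
      ¬ IsWeightModule σ a (socle (GWA σ a) (Vp σ p.2)) ∧
      (∃ p' : {p : R // p ∣ a}, IsHat σ p p') ∧
      (∀ p' : {p : R // p ∣ a}, IsHat σ p p' →
        Nonempty (socle (GWA σ a) (Vp σ p.2) ≃ₗ[GWA σ a] Vp σ p'.2)) ∧
      -- the composition factors: the bottom one is the socle, all others are weight modules
      (∀ s : CompositionSeries (Submodule (GWA σ a) (Vp σ p.2)), s.head = ⊥ → s.last = ⊤ →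
        ∀ i : Fin s.length,
          ((i : ℕ) = 0 → s i.succ = socle (GWA σ a) (Vp σ p.2)) ∧
          ((i : ℕ) ≠ 0 → IsSimpleModule (GWA σ a) (CompFactor s i) ∧
            IsWeightModule σ a (CompFactor s i) ∧
            (weightSupport σ a (CompFactor s i)).Finite))) ∧
    -- part (b)
    (∀ (M : Type v) [AddCommGroup M] [Module (GWA σ a) M],
      IsSimpleModule (GWA σ a) M → IsWeightModule σ a M → (weightSupport σ a M).Finite →
        ∃ (p : {p : R // p ∣ a}) (s : CompositionSeries (Submodule (GWA σ a) (Vp σ p.2))),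
          s.head = ⊥ ∧ s.last = ⊤ ∧
          ∃ i : Fin s.length, Nonempty (M ≃ₗ[GWA σ a] CompFactor s i)) := by
  refine ⟨fun p => ⟨Vp.isFiniteLength hσ ha, Vp.isSimpleModule_socle hσ ha, ?_,
    Vp.exists_isHat hσ ha p, fun p' hp' => Vp.socle_equiv_of_isHat hσ ha hp',
    fun s hs _ i => ⟨Vp.compFactor_zero s hs i, Vp.compFactor_pos s i⟩⟩, ?_⟩
  · exact Vp.not_isWeightModule_submodule hR
      (isSimpleModule_iff_isAtom.1 (Vp.isSimpleModule_socle hσ ha)).1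
  · intro M _ _ hM hw hfin
    obtain ⟨p, f, hf⟩ := exists_surjective_of_finite_weightSupport hR hσ hw hfin
    obtain ⟨s, hs⟩ := exists_compFactor_equiv_of_surjective (Vp.isFiniteLength hσ ha) f hf
    exact ⟨p, s, hs⟩
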